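/- Let $A$ be a finite alphabet, let $f\colon A^*\to A^*$ be a morphism, and let $\mathbf{x}\in A^{\mathbb N}$ be a pure morphic word generated by $f$; that is, $f(a)=au$ for some letter $a\in A$ and some word $u\in A^+$ with $f^n(u)\neq\epsilon$ for all $n\ge 0$, and $\mathbf{x}=f^\omega(a)=\lim_{n\to\infty}f^n(a)$ is the infinite word having every $f^n(a)$ as a prefix. Let $\mathcal S_{\mathbf{x}}\subseteq A^{\mathbb N}$ be the shift orbit closure of $\mathbf{x}$, that is, the set of all infinite words over $A$ all of whose finite factors are factors of $\mathbf{x}$. Suppose that $f\in\mathcal M_{\mathbf{x}}$, which means: for each letter $b\in A$ there is a nonempty finite word $p_b\in A^+$ such that $f(\mathbf{y})$ begins with $p_b$ for every $\mathbf{y}\in\mathcal S_{\mathbf{x}}$ that begins with $b$, and such that for all letters $a\neq b$ neither of $p_a$ and $p_b$ is a prefix of the other. Then every extremal word of $\mathbf{x}$ is morphic: if $\sigma$ is a total order on $A$, $b\in A$ is a letter, and $\mathbf{y}$ is the least word, with respect to the lexicographic order induced by $\sigma$, among the words in $\mathcal S_{\mathbf{x}}$ that begin with $b$, then there are a finite alphabet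 $C$, a morphism $g\colon C^*\to C^*$, a pure morphic word $\mathbf{z}\in C^{\mathbb N}$ generated by $g$ (in the sense above), and a coding (letter-to-letter morphism) $c\colon C^*\to A^*$ such that $\mathbf{y}=c(\mathbf{z})$. -/

import Mathlib

namespace MorphicWords

/-- The finite word formed by the first `n` letters of the infinite word `x`. -/
def take {A : Type*} (x : ℕ → A) (n : ℕ) : List A :=
  (List.range n).map x

/-- The finite word `w` is a prefix of the infinite word `x`. -/
def IsPrefixOf {A : Type*} (w : List A) (x : ℕ → A) : Prop :=
  take x w.length = w

/-- The set `F(x)` of the (finite) factors of the infinite word `x`. -/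
def factors {A : Type*} (x : ℕ → A) : Set (List A) :=
  {w | ∃ i n : ℕ, w = take (fun j => x (i + j)) n}

/-- The shift orbit closure `S_x`: all infinite words whose factors are factors of `x`. -/
def orbitClosure {A : Type*} (x : ℕ → A) : Set (ℕ → A) :=
  {y | factors y ⊆ factors x}

/-- `x = f^ω(a)` for some letter `a` such that `f(a) = au` with `u` nonempty and `f^n(u)` nonempty
for all `n`; the word `f^ω(a)` is the infinite word that has every `f^n(a)` as a prefix. -/
def IsPureMorphicGeneratedBy {A : Type*} (f : FreeMonoid A →* FreeMonoid A) (x : ℕ → A) : Prop :=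
  ∃ (a : A) (u : FreeMonoid A), u ≠ 1 ∧ f (FreeMonoid.of a) = FreeMonoid.of a * u ∧
    (∀ n : ℕ, f^[n] u ≠ 1) ∧
    ∀ n : ℕ, IsPrefixOf (f^[n] (FreeMonoid.of a)).toList x

/-- A morphic word: the image under a coding (letter-to-letter map) of a pure morphic word over
some finite alphabet. -/
def IsMorphic {B : Type*} (y : ℕ → B) : Prop :=
  ∃ (C : Type) (_ : Finite C) (g : FreeMonoid C →* FreeMonoid C) (z : ℕ → C) (c : C → B),
    IsPureMorphicGeneratedBy g z ∧ ∀ i : ℕ, y i = c (z i)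

/-- The (finite or infinite) word `f(y)` begins with the finite word `p`. -/
def ImageBeginsWith {A B : Type*} (f : FreeMonoid A →* FreeMonoid B) (y : ℕ → A)
    (p : List B) : Prop :=
  ∃ n : ℕ, p <+: (f (FreeMonoid.ofList (take y n))).toList

/-- The condition `f ∈ M_x`. -/
def MemM {A B : Type*} (f : FreeMonoid A →* FreeMonoid B) (x : ℕ → A) : Prop :=
  ∃ p : A → List B, (∀ b, p b ≠ []) ∧
    (∀ b, ∀ y ∈ orbitClosure x, y 0 = b → ImageBeginsWith f y (p b)) ∧
    ∀ a b, a ≠ b → ¬ p a <+: p b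

/-- The strict lexicographic order on infinite words induced by the strict order `σ` on letters. -/
def LexLT {A : Type*} (σ : A → A → Prop) (y z : ℕ → A) : Prop :=
  Pi.Lex (· < ·) (fun {_} => σ) y z

/-- `y` is an extremal word of `x`: for some (strict) total order `σ` on the alphabet and some
letter `b`, it is the lexicographically least word of `S_x` that begins with `b`. -/
def IsExtremal {A : Type*} (x y : ℕ → A) : Prop :=
  ∃ (σ : A → A → Prop) (b : A), IsStrictTotalOrder A σ ∧ y ∈ orbitClosure x ∧ y 0 = b ∧
    ∀ z ∈ orbitClosure x, z 0 = b → z = y ∨ LexLT σ y z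

end MorphicWords

/-! The proof runs desubstitution backwards until it cycles. Membership in `MemM` makes `f`
nonerasing on the letters of `x` (`ne_nil_of_memM`), so `f` may be replaced by a nonerasing `φ`
fixing `x`. A minimal word `y` is a suffix of some `φ(y')`, cut inside the image of the first
letter, and `y'` is again minimal, for the order comparing letters through the words `p`
(`exists_isMinimalIn_desubst`). A minimal word is determined by its order and its first letter, and
there are finitely many such pairs, so iteration reaches a word `s` that is a suffix of `F(s)`, with
`F = φ^k`, and `y` is a suffix of `φ^m(s)` (`exists_isDesubst_self`).

Then `F(s 0)` ends in `s 0` followed by some `w`, and the tail of `s` is `w` followed by its own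
image under `F`. If `w` is nonempty, a tail of `y` is a series `W F(W) F²(W) ⋯`, which is morphic,
even after letters are prepended (`isMorphic_of_isSubstSeries_shift`). If `w` is empty, a tail `t`
of `y` satisfies `F(t) = t`. Past the first letter of `t` not fixed by `F` there is again a series.
If all letters of `t` are fixed, `t` is ultimately periodic (`eventually_periodic_of_forall_fixed`).
-/

namespace MorphicWords

/-! ### Prefixes, shifts and images of infinite words under nonerasing morphisms. -/

variable {A : Type*}

/-- The infinite word obtained by removing the first `k` letters. -/
def shift (k : ℕ) (y : ℕ → A) : ℕ → A := fun i => y (k + i)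

/-- The action on finite words of the morphism given by `φ` on letters. -/
def subst (φ : A → List A) (w : List A) : List A := w.flatMap φ

@[simp] lemma length_take (x : ℕ → A) (n : ℕ) : (take x n).length = n := by simp [take]

@[simp] lemma getElem_take (x : ℕ → A) (n i : ℕ) (h : i < (take x n).length) :
    (take x n)[i] = x i := by simp [take]

lemma isPrefixOf_iff {w : List A} {x : ℕ → A} :
    IsPrefixOf w x ↔ ∀ i (h : i < w.length), w[i] = x i := by
  unfold IsPrefixOf
  constructor
  · intro h i hi
    have := getElem_take x w.length i (by simpa using hi)
    simpa [h] using this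
  · intro h
    apply List.ext_getElem
    · simp
    · intro i h1 h2
      simp [h i h2]

lemma isPrefixOf_take (x : ℕ → A) (n : ℕ) : IsPrefixOf (take x n) x := by
  simp [isPrefixOf_iff]

lemma take_eq_take_iff {x y : ℕ → A} {n : ℕ} : take x n = take y n ↔ ∀ i < n, x i = y i := by
  constructor
  · intro h i hi
    have := getElem_take x n i (by simpa using hi)
    rw [← this]
    simp [h]
  · intro h
    apply List.ext_getElem
    · simp
    · intro i h1 h2
      simpa using h i (by simpa using h1)

lemma IsPrefixOf.of_prefix {u w : List A} {x : ℕ → A} (h : IsPrefixOf w x) (hu : u <+: w) :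
    IsPrefixOf u x := by
  rw [isPrefixOf_iff] at *
  intro i hi
  rw [← h i (hi.trans_le hu.length_le), hu.getElem hi]

lemma isPrefixOf_append {u v : List A} {x : ℕ → A} :
    IsPrefixOf (u ++ v) x ↔ IsPrefixOf u x ∧ IsPrefixOf v (shift u.length x) := by
  simp only [isPrefixOf_iff, shift]
  constructor
  · intro h
    refine ⟨fun i hi => ?_, fun i hi => ?_⟩
    · rw [← h i (by simp; omega), List.getElem_append_left]
    · rw [← h (u.length + i) (by simp; omega), List.getElem_append_right (by omega)]
      simp
  · rintro ⟨h1, h2⟩ i hi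
    by_cases hu : i < u.length
    · rw [List.getElem_append_left hu, h1]
    · rw [List.getElem_append_right (by omega), h2]
      congr 1; omega

lemma isPrefixOf_cons {a : A} {v : List A} {x : ℕ → A} :
    IsPrefixOf (a :: v) x ↔ a = x 0 ∧ IsPrefixOf v (shift 1 x) := by
  rw [show a :: v = [a] ++ v from rfl, isPrefixOf_append]
  simp [isPrefixOf_iff]

lemma IsPrefixOf.prefix_of_le {u w : List A} {x : ℕ → A} (hu : IsPrefixOf u x)
    (hw : IsPrefixOf w x) (h : u.length ≤ w.length) : u <+: w := by
  rw [isPrefixOf_iff] at *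
  rw [List.prefix_iff_getElem]
  exact ⟨h, fun i hi => by rw [hu, hw]⟩

lemma take_prefix_take (x : ℕ → A) {m n : ℕ} (h : m ≤ n) : take x m <+: take x n :=
  (isPrefixOf_take x m).prefix_of_le (isPrefixOf_take x n) (by simpa)

lemma take_add (x : ℕ → A) (m n : ℕ) : take x (m + n) = take x m ++ take (shift m x) n := by
  have : IsPrefixOf (take x m ++ take (shift m x) n) x := by
    rw [isPrefixOf_append, length_take]
    exact ⟨isPrefixOf_take _ _, isPrefixOf_take _ _⟩
  unfold IsPrefixOf at this
  simpa using this

@[simp] lemma take_one (x : ℕ → A) : take x 1 = [x 0] := rfl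

lemma take_succ (x : ℕ → A) (n : ℕ) : take x (n + 1) = x 0 :: take (shift 1 x) n := by
  rw [add_comm, take_add]; rfl

lemma take_succ' (x : ℕ → A) (n : ℕ) : take x (n + 1) = take x n ++ [x n] := by
  rw [take_add]; rfl

lemma shift_shift (m n : ℕ) (x : ℕ → A) : shift m (shift n x) = shift (n + m) x := by
  funext i; simp [shift, add_assoc]

@[simp] lemma shift_zero (x : ℕ → A) : shift 0 x = x := by
  funext i; simp [shift]

lemma eq_of_forall_take {x y : ℕ → A} (h : ∀ n, take x n = take y n) : x = y :=
  funext fun i => take_eq_take_iff.1 (h (i + 1)) i (by omega)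

section subst

variable (φ ψ : A → List A)

@[simp] lemma subst_nil : subst φ [] = [] := rfl

@[simp] lemma subst_cons (a : A) (w : List A) : subst φ (a :: w) = φ a ++ subst φ w := rfl

@[simp] lemma subst_append (u w : List A) : subst φ (u ++ w) = subst φ u ++ subst φ w := by
  simp [subst]

lemma subst_prefix {u w : List A} (h : u <+: w) : subst φ u <+: subst φ w := by
  obtain ⟨v, rfl⟩ := h
  simp

lemma subst_subst (w : List A) :
    subst φ (subst ψ w) = subst (fun a => subst φ (ψ a)) w := by
  induction w with
  | nil => rfl
  | cons a w ih => simp [ih]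

@[simp] lemma subst_singleton (w : List A) : subst (fun a => [a]) w = w := by
  induction w with
  | nil => rfl
  | cons a w ih => simp [ih]

variable {φ ψ}

lemma subst_congr {w : List A} (h : ∀ a ∈ w, φ a = ψ a) : subst φ w = subst ψ w := by
  induction w with
  | nil => rfl
  | cons a w ih => simp_all

lemma subst_eq_self {w : List A} (h : ∀ a ∈ w, φ a = [a]) : subst φ w = w := by
  rw [subst_congr (ψ := fun a => [a]) h, subst_singleton]

lemma length_le_length_subst (h : ∀ a, φ a ≠ []) (w : List A) :
    w.length ≤ (subst φ w).length := by
  induction w with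
  | nil => simp
  | cons a w ih =>
    have := List.length_pos_iff.2 (h a)
    simp; omega

lemma subst_ne_nil (h : ∀ a, φ a ≠ []) {w : List A} (hw : w ≠ []) : subst φ w ≠ [] := by
  rw [← List.length_pos_iff] at *
  exact hw.trans_le (length_le_length_subst h w)

lemma mem_subst {w : List A} {a : A} : a ∈ subst φ w ↔ ∃ b ∈ w, a ∈ φ b := by
  simp [subst]

/-- The image of an infinite word under a nonerasing morphism. -/
def img (φ : A → List A) (y : ℕ → A) : ℕ → A :=
  fun i => (subst φ (take y (i + 1))).getD i (y 0)

/-- Since `φ` is nonerasing, `i + 1` letters have an image of length more than `i`, so the default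
value in `img` is never read. -/
lemma isPrefixOf_subst_take (h : ∀ a, φ a ≠ []) (y : ℕ → A) (n : ℕ) :
    IsPrefixOf (subst φ (take y n)) (img φ y) := by
  rw [isPrefixOf_iff]
  intro i hi
  have hi' : i < (subst φ (take y (i + 1))).length :=
    lt_of_lt_of_le (by simp) (length_le_length_subst h _)
  rw [img, List.getD_eq_getElem _ _ hi']
  rcases le_total n (i + 1) with hn | hn
  · exact (subst_prefix φ (take_prefix_take y hn)).getElem hi
  · exact ((subst_prefix φ (take_prefix_take y hn)).getElem hi').symm

lemma IsPrefixOf.subst (h : ∀ a, φ a ≠ []) {w : List A} {y : ℕ → A} (hw : IsPrefixOf w y) :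
    IsPrefixOf (subst φ w) (img φ y) := by
  rw [← show take y w.length = w from hw]
  exact isPrefixOf_subst_take h y _

lemma eq_img (h : ∀ a, φ a ≠ []) {y z : ℕ → A}
    (hz : ∀ n, IsPrefixOf (MorphicWords.subst φ (take y n)) z) : z = img φ y := by
  funext i
  have hi : i < (MorphicWords.subst φ (take y (i + 1))).length :=
    lt_of_lt_of_le (by simp) (length_le_length_subst h _)
  rw [← isPrefixOf_iff.1 (hz (i + 1)) i hi,
    isPrefixOf_iff.1 (isPrefixOf_subst_take h y (i + 1)) i hi]

lemma img_shift (h : ∀ a, φ a ≠ []) (y : ℕ → A) (k : ℕ) :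
    img φ (shift k y) = shift (MorphicWords.subst φ (take y k)).length (img φ y) := by
  symm
  apply eq_img h
  intro n
  have := isPrefixOf_subst_take h y (k + n)
  rw [take_add, subst_append, isPrefixOf_append] at this
  exact this.2

lemma img_congr {y z : ℕ → A} {n : ℕ} (hyz : take y n = take z n) :
    take (img φ y) n = take (img φ z) n := by
  rw [take_eq_take_iff] at *
  intro i hi
  have : take y (i + 1) = take z (i + 1) :=
    take_eq_take_iff.2 fun j hj => hyz j (by omega)
  simp only [img, this, hyz 0 (by omega)]

lemma img_img (h : ∀ a, φ a ≠ []) (h' : ∀ a, ψ a ≠ []) (y : ℕ → A) :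
    img φ (img ψ y) = img (fun a => MorphicWords.subst φ (ψ a)) y := by
  apply eq_img (fun a => subst_ne_nil h (h' a))
  intro n
  rw [← subst_subst]
  exact (isPrefixOf_subst_take h' y n).subst h

end subst

section pow

variable {φ : A → List A}

/-- The iterates of a morphism, given on letters. -/
def pow (φ : A → List A) (k : ℕ) (a : A) : List A := (subst φ)^[k] [a]

@[simp] lemma pow_zero_apply (a : A) : pow φ 0 a = [a] := rfl

lemma pow_one_eq : pow φ 1 = φ := by funext a; simp [pow]

lemma subst_pow (k : ℕ) (w : List A) : subst (pow φ k) w = (subst φ)^[k] w := by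
  induction w with
  | nil => simpa using (Function.iterate_fixed (subst_nil φ) k).symm
  | cons a w ih =>
    have : ∀ (k : ℕ) (u v : List A),
        (subst φ)^[k] (u ++ v) = (subst φ)^[k] u ++ (subst φ)^[k] v := by
      intro k
      induction k with
      | zero => simp
      | succ k ih => intro u v; simp [ih]
    rw [subst_cons, ih, pow, ← this]; rfl

lemma subst_pow_pow (k m : ℕ) (a : A) : subst (pow φ k) (pow φ m a) = pow φ (k + m) a := by
  rw [subst_pow, pow, pow, ← Function.iterate_add_apply]

lemma pow_ne_nil (h : ∀ a, φ a ≠ []) (k : ℕ) (a : A) : pow φ k a ≠ [] := by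
  induction k with
  | zero => simp
  | succ k ih =>
    rw [add_comm, ← subst_pow_pow, pow_one_eq]
    exact subst_ne_nil h ih

lemma pow_mul (k m : ℕ) (a : A) : pow (pow φ k) m a = pow φ (k * m) a := by
  induction m with
  | zero => rfl
  | succ m ih => rw [add_comm, ← subst_pow_pow, ih, pow_one_eq, subst_pow_pow]; congr 1; ring

lemma img_pow_img_pow (h : ∀ a, φ a ≠ []) (k m : ℕ) (y : ℕ → A) :
    img (pow φ k) (img (pow φ m) y) = img (pow φ (k + m)) y := by
  rw [img_img (pow_ne_nil h k) (pow_ne_nil h m)]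
  simp only [subst_pow_pow]

end pow

lemma eq_of_prefix_of_shift {w : List A} {x y : ℕ → A} (hx : IsPrefixOf w x)
    (hy : IsPrefixOf w y) (h : shift w.length x = shift w.length y) : x = y := by
  rw [isPrefixOf_iff] at hx hy
  funext i
  by_cases hi : i < w.length
  · rw [← hx i hi, hy i hi]
  · have := congrFun h (i - w.length)
    simpa [shift, Nat.add_sub_cancel' (not_lt.1 hi)] using this

lemma toList_eq_subst (f : FreeMonoid A →* FreeMonoid A) (w : FreeMonoid A) :
    (f w).toList = subst (fun a => (f (FreeMonoid.of a)).toList) w.toList := by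
  induction w using FreeMonoid.recOn with
  | one => simp
  | of_mul a w ih => simp [ih]

lemma toList_iterate_eq_subst (f : FreeMonoid A →* FreeMonoid A) (n : ℕ) (w : FreeMonoid A) :
    (f^[n] w).toList = (subst fun a => (f (FreeMonoid.of a)).toList)^[n] w.toList := by
  induction n with
  | zero => rfl
  | succ n ih => rw [Function.iterate_succ_apply', Function.iterate_succ_apply', toList_eq_subst, ih]

lemma isPureMorphicGeneratedBy_of_img_eq {φ : A → List A} (h : ∀ a, φ a ≠ []) {z : ℕ → A}
    (hz : img φ z = z) {u : List A} (hu : u ≠ []) (ha : φ (z 0) = z 0 :: u) :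
    IsPureMorphicGeneratedBy (FreeMonoid.lift fun a => FreeMonoid.ofList (φ a)) z := by
  have key : (fun a => (FreeMonoid.lift (fun a => FreeMonoid.ofList (φ a))
      (FreeMonoid.of a)).toList) = φ := by
    funext a; simp
  refine ⟨z 0, FreeMonoid.ofList u, fun h0 => hu h0, ?_, ?_, ?_⟩
  · rw [FreeMonoid.lift_eval_of, ha]; rfl
  · intro n h0
    have h1 := congrArg FreeMonoid.toList h0
    rw [toList_iterate_eq_subst, key, ← subst_pow] at h1
    exact subst_ne_nil (pow_ne_nil h n) hu h1
  · intro n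
    rw [toList_iterate_eq_subst, key]
    induction n with
    | zero => simp [isPrefixOf_iff]
    | succ n ih =>
      rw [Function.iterate_succ_apply']
      simpa only [hz] using ih.subst h

/-! ### Substitution series and their morphicity. -/

/-- Infinite words of the form `c (w F(w) F²(w) ⋯)` with `F` nonerasing and `w` nonempty. -/
def IsSubstSeries {B : Type*} (y : ℕ → B) : Prop :=
  ∃ (C : Type) (_ : Finite C) (F : C → List C) (w : List C) (t : ℕ → C) (c : C → B),
    (∀ a, F a ≠ []) ∧ w ≠ [] ∧ IsPrefixOf w t ∧ shift w.length t = img F t ∧ y = c ∘ t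

lemma subst_map {C D : Type*} {F : C → List C} {G : D → List D} {e : C → D}
    (h : ∀ a, G (e a) = (F a).map e) (w : List C) : subst G (w.map e) = (subst F w).map e := by
  induction w with
  | nil => rfl
  | cons a w ih => simp [ih, h]

lemma take_comp {C D : Type*} (e : C → D) (t : ℕ → C) (n : ℕ) :
    take (e ∘ t) n = (take t n).map e := by
  simp [take]

lemma IsPrefixOf.map {C D : Type*} {w : List C} {t : ℕ → C} (h : IsPrefixOf w t) (e : C → D) :
    IsPrefixOf (w.map e) (e ∘ t) := by
  unfold IsPrefixOf at *
  rw [List.length_map, take_comp, h]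

lemma img_comp {C D : Type*} {F : C → List C} {G : D → List D} {e : C → D}
    (hF : ∀ a, F a ≠ []) (hG : ∀ a, G a ≠ []) (h : ∀ a, G (e a) = (F a).map e) (t : ℕ → C) :
    img G (e ∘ t) = e ∘ img F t := by
  symm
  apply eq_img hG
  intro n
  rw [take_comp, subst_map h]
  exact (isPrefixOf_subst_take hF t n).map e

lemma isSubstSeries_of_shift_eq_img [Finite A] {F : A → List A} (hF : ∀ a, F a ≠ []) {w : List A}
    (hw : w ≠ []) {t : ℕ → A} (hwt : IsPrefixOf w t) (ht : shift w.length t = img F t) :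
    IsSubstSeries t := by
  -- `IsSubstSeries` wants an alphabet in `Type`, so `A` is transported to `Fin n`.
  obtain ⟨n, ⟨e⟩⟩ := Finite.exists_equiv_fin A
  have hG : ∀ b, (fun b => (F (e.symm b)).map e) b ≠ [] := fun b => by simpa using hF _
  refine ⟨Fin n, inferInstance, fun b => (F (e.symm b)).map e, w.map e, e ∘ t, e.symm, hG,
    by simpa using hw, hwt.map e, ?_, by funext i; simp⟩
  rw [img_comp hF hG (by simp), ← ht, List.length_map]
  rfl

/-- The infinite word obtained by prepending a letter. -/
def consWord {C : Type*} (a : C) (t : ℕ → C) : ℕ → C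
  | 0 => a
  | i + 1 => t i

@[simp] lemma shift_one_consWord {C : Type*} (a : C) (t : ℕ → C) :
    shift 1 (consWord a t) = t := by
  funext i
  simp [shift, add_comm 1 i, consWord]

lemma eq_comp_consWord {B C : Type*} {y : ℕ → B} {c : C → B} {t : ℕ → C}
    (h : shift 1 y = c ∘ t) :
    y = (fun o : Option C => o.elim (y 0) c) ∘ consWord none (some ∘ t) := by
  funext i
  cases i with
  | zero => rfl
  | succ i => simpa [shift, add_comm 1 i, consWord] using congrFun h i

lemma isPrefixOf_img_zero {φ : A → List A} (h : ∀ a, φ a ≠ []) (y : ℕ → A) :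
    IsPrefixOf (φ (y 0)) (img φ y) := by
  simpa using isPrefixOf_subst_take h y 1

lemma img_shift_one {φ : A → List A} (h : ∀ a, φ a ≠ []) (y : ℕ → A) :
    shift (φ (y 0)).length (img φ y) = img φ (shift 1 y) := by
  simpa using (img_shift h y 1).symm

/-- A new letter `none`, decoded to `y 0` and mapped to `w`, becomes the starting word of a longer
series. -/
lemma IsSubstSeries.of_shift_one {B : Type*} {y : ℕ → B} (h : IsSubstSeries (shift 1 y)) :
    IsSubstSeries y := by
  obtain ⟨C, _, F, w, t, c, hF, hw, hwt, ht, hy⟩ := h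
  let G : Option C → List (Option C) := fun o => o.elim (w.map some) fun a => (F a).map some
  have hG : ∀ b, G b ≠ [] := by rintro (_ | a) <;> simp [G, hw, hF]
  refine ⟨Option C, inferInstance, G, [none], consWord none (some ∘ t),
    fun o => o.elim (y 0) c, hG, by simp, by simp [isPrefixOf_iff, consWord], ?_, eq_comp_consWord hy⟩
  rw [List.length_singleton, shift_one_consWord]
  refine eq_of_prefix_of_shift (hwt.map some) (isPrefixOf_img_zero hG _) ?_
  have h2 := img_shift_one hG (consWord none (some ∘ t))
  rw [shift_one_consWord, img_comp hF hG (fun _ => rfl), ← ht] at h2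
  exact (congrArg (fun n => shift n (some ∘ t)) (List.length_map _)).trans h2.symm

/-- With `none` mapped to `none` followed by `w`, the extended word is a fixed point generated by
`none`. -/
lemma IsSubstSeries.isMorphic_of_shift_one {B : Type*} {y : ℕ → B}
    (h : IsSubstSeries (shift 1 y)) : IsMorphic y := by
  obtain ⟨C, _, F, w, t, c, hF, hw, hwt, ht, hy⟩ := h
  let G : Option C → List (Option C) :=
    fun o => o.elim (none :: w.map some) fun a => (F a).map some
  have hG : ∀ b, G b ≠ [] := by rintro (_ | a) <;> simp [G, hF]
  refine ⟨Option C, inferInstance, _, consWord none (some ∘ t), fun o => o.elim (y 0) c,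
    isPureMorphicGeneratedBy_of_img_eq (φ := G) (u := w.map some) hG ?_ (by simpa using hw) rfl,
    congrFun (eq_comp_consWord hy)⟩
  symm
  refine eq_of_prefix_of_shift (w := none :: w.map some) ?_ (isPrefixOf_img_zero hG _) ?_
  · rw [isPrefixOf_cons, shift_one_consWord]
    exact ⟨rfl, hwt.map some⟩
  · have h2 := img_shift_one hG (consWord none (some ∘ t))
    rw [shift_one_consWord, img_comp hF hG (fun _ => rfl), ← ht] at h2
    refine Eq.trans ?_ h2.symm
    rw [List.length_cons, add_comm, ← shift_shift, shift_one_consWord, List.length_map]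
    rfl

lemma isMorphic_of_isSubstSeries_shift {B : Type*} {y : ℕ → B} {k : ℕ}
    (h : IsSubstSeries (shift (k + 1) y)) : IsMorphic y := by
  apply IsSubstSeries.isMorphic_of_shift_one
  induction k with
  | zero => exact h
  | succ k ih =>
    apply ih
    apply IsSubstSeries.of_shift_one
    rwa [shift_shift]

/-- The periodic tail is the series of its period under the identity morphism. -/
lemma isMorphic_of_eventually_periodic [Finite A] {y : ℕ → A} {p N : ℕ} (hp : 0 < p)
    (h : ∀ i, N ≤ i → y i = y (i + p)) : IsMorphic y := by
  refine isMorphic_of_isSubstSeries_shift (k := N) ?_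
  refine isSubstSeries_of_shift_eq_img (F := fun a => [a]) (w := take (shift (N + 1) y) p)
    (by simp) ?_ (isPrefixOf_take _ _) ?_
  · rw [← List.length_pos_iff]; simpa
  · apply eq_img (by simp)
    intro n
    have : shift p (shift (N + 1) y) = shift (N + 1) y := by
      funext i
      simp only [shift]
      rw [h (N + 1 + i) (by omega)]
      congr 1; ring
    rw [subst_singleton, length_take, this]
    exact isPrefixOf_take _ _

end MorphicWords

namespace MorphicWords

/-! ### Periodicity of long factors made of fixed letters. -/

variable {A : Type*} {F : A → List A}

/-- Every letter of `w` is fixed by the morphism `F`. -/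
def IsFixed (F : A → List A) (w : List A) : Prop := ∀ a ∈ w, F a = [a]

lemma IsFixed.of_subset {u w : List A} (h : IsFixed F w) (hu : u ⊆ w) : IsFixed F u :=
  fun a ha => h a (hu ha)

lemma pow_eq_singleton {a : A} (h : F a = [a]) (k : ℕ) : pow F k a = [a] :=
  Function.iterate_fixed (by simp [h]) k

lemma IsFixed.subst_pow {w : List A} (h : IsFixed F w) (k : ℕ) : subst (pow F k) w = w :=
  subst_eq_self fun a ha => pow_eq_singleton (h a ha) k

/-- Some iterate of `F` sends the letter `a` to a word of fixed letters. -/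
def IsEventuallyFixed (F : A → List A) (a : A) : Prop := ∃ m, IsFixed F (pow F m a)

lemma IsFixed.pow_add {a : A} {m : ℕ} (h : IsFixed F (pow F m a)) (k : ℕ) :
    pow F (k + m) a = pow F m a := by
  rw [← subst_pow_pow, h.subst_pow]

lemma exists_isFixed_pow [Finite A] (F : A → List A) :
    ∃ M, ∀ a, IsEventuallyFixed F a → ∀ k, IsFixed F (pow F (k + M) a) := by
  have : ∀ a, ∃ m, IsEventuallyFixed F a → IsFixed F (pow F m a) := by
    intro a
    by_cases h : IsEventuallyFixed F a
    · exact h.imp fun m hm _ => hm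
    · exact ⟨0, fun h' => absurd h' h⟩
  choose m hm using this
  cases nonempty_fintype A
  refine ⟨∑ a, m a, fun a ha k => ?_⟩
  have h1 : m a ≤ ∑ a, m a := Finset.single_le_sum (fun _ _ => Nat.zero_le _) (Finset.mem_univ a)
  obtain ⟨j, hj⟩ := Nat.exists_eq_add_of_le' h1
  rw [hj, ← add_assoc, (hm a ha).pow_add]
  exact hm a ha

lemma pow_add_apply (k m : ℕ) (a : A) : pow F (k + m) a = subst (pow F k) (pow F m a) :=
  (subst_pow_pow k m a).symm

lemma length_pow_le (hF : ∀ a, F a ≠ []) {a : A} {m : ℕ} (h : IsFixed F (pow F m a)) (k : ℕ) :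
    (pow F k a).length ≤ (pow F m a).length := by
  rw [← h.pow_add k, add_comm, pow_add_apply]
  exact length_le_length_subst (pow_ne_nil hF m) _

lemma exists_split_of_not_forall {P : A → Prop} {l : List A} (h : ¬ ∀ a ∈ l, P a) :
    ∃ u a v, l = u ++ a :: v ∧ (∀ b ∈ u, P b) ∧ ¬ P a := by
  induction l with
  | nil => simp at h
  | cons b l ih =>
    by_cases hb : P b
    · obtain ⟨u, a, v, rfl, h1, h2⟩ := ih (by simpa [hb] using h)
      exact ⟨b :: u, a, v, rfl, by simpa [hb] using h1, h2⟩
    · exact ⟨[], b, l, rfl, by simp, hb⟩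

lemma exists_split_of_not_isEventuallyFixed [Finite A] {a : A} (h : ¬ IsEventuallyFixed F a) :
    ∃ u b v, F a = u ++ b :: v ∧ (∀ c ∈ u, IsEventuallyFixed F c) ∧ ¬ IsEventuallyFixed F b := by
  apply exists_split_of_not_forall
  intro h'
  obtain ⟨M, hM⟩ := exists_isFixed_pow F
  refine h ⟨M + 1, fun c hc => ?_⟩
  rw [pow_add_apply, pow_one_eq, mem_subst] at hc
  obtain ⟨b, hb, hc⟩ := hc
  exact hM b (h' b hb) 0 c (by simpa using hc)

/-- The word `V(e) V(s(e)) ⋯ V(s^(m-1)(e))`. -/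
def orbitConcat (V : A → List A) (s : A → A) : ℕ → A → List A
  | 0, _ => []
  | m + 1, e => V e ++ orbitConcat V s m (s e)

lemma orbitConcat_add (V : A → List A) (s : A → A) (m k : ℕ) (e : A) :
    orbitConcat V s (m + k) e = orbitConcat V s m e ++ orbitConcat V s k (s^[m] e) := by
  induction m generalizing e with
  | zero => simp [orbitConcat]
  | succ m ih => rw [Nat.add_right_comm]; simp [orbitConcat, ih]

lemma orbitConcat_mul_eq_nil {V : A → List A} {s : A → A} {q : ℕ} {e : A} (hq : s^[q] e = e)
    (h : orbitConcat V s q e = []) (r : ℕ) : orbitConcat V s (r * q) e = [] := by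
  induction r with
  | zero => simp [orbitConcat]
  | succ r ih => rw [add_mul, add_comm, one_mul, orbitConcat_add, h, hq, ih]; rfl

/-- The word `u` has period `p` from position `N` on. -/
def HasPeriodFrom (p N : ℕ) (u : List A) : Prop :=
  ∀ i, N ≤ i → i + p < u.length → u[i]? = u[i + p]?

lemma HasPeriodFrom.mono {p N p' N' : ℕ} {u : List A} (h : HasPeriodFrom p N u) (hp : p ∣ p')
    (hN : N ≤ N') : HasPeriodFrom p' N' u := by
  obtain ⟨k, rfl⟩ := hp
  intro i hi hlt
  induction k with
  | zero => simp
  | succ k ih =>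
    rw [mul_add, mul_one, ← add_assoc] at hlt ⊢
    rw [ih (by omega), h _ (by omega) hlt]

/-- The orbit of `e` under `s` is ultimately periodic, and the concatenation over one cycle gives
the period. -/
lemma exists_hasPeriodFrom_orbitConcat [Finite A] (V : A → List A) (s : A → A) (e : A) :
    ∃ p N, 0 < p ∧ ∀ m u, u <+: orbitConcat V s m e → HasPeriodFrom p N u := by
  obtain ⟨a, b, hab, hs⟩ : ∃ a b, a < b ∧ s^[a] e = s^[b] e := by
    obtain ⟨a, b, hne, h⟩ := Finite.exists_ne_map_eq_of_infinite fun n => s^[n] e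
    rcases hne.lt_or_gt with h' | h'
    · exact ⟨a, b, h', h⟩
    · exact ⟨b, a, h', h.symm⟩
  obtain ⟨q, rfl⟩ := Nat.exists_eq_add_of_lt hab
  set e₁ := s^[a] e with he₁
  have hq : s^[q + 1] e₁ = e₁ := by
    rw [he₁, ← Function.iterate_add_apply, show q + 1 + a = a + q + 1 by omega, ← hs]
  have hpre : ∀ m u, u <+: orbitConcat V s m e →
      u <+: orbitConcat V s a e ++ orbitConcat V s m e₁ := by
    intro m u hu
    rw [he₁, ← orbitConcat_add, add_comm, orbitConcat_add]
    exact hu.trans (List.prefix_append _ _)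
  -- If the cycle contributes nothing, the words have bounded length and any period works vacuously.
  by_cases hP : orbitConcat V s (q + 1) e₁ = []
  · refine ⟨1, (orbitConcat V s a e).length, one_pos, fun m u hu i hi hlt => ?_⟩
    have h1 : orbitConcat V s m e₁ = [] := by
      have := orbitConcat_mul_eq_nil hq hP m
      rw [mul_add, mul_one, add_comm, orbitConcat_add] at this
      exact (List.append_eq_nil_iff.1 this).1
    have := (hpre m u hu).length_le
    simp only [h1, List.append_nil] at this
    omega
  · refine ⟨(orbitConcat V s (q + 1) e₁).length, (orbitConcat V s a e).length,
      List.length_pos_iff.2 hP, fun m u hu i hi hlt => ?_⟩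
    have h1 : orbitConcat V s m e₁ <+:
        orbitConcat V s (q + 1) e₁ ++ orbitConcat V s m e₁ := by
      conv_rhs => rw [← congrArg (orbitConcat V s m) hq, ← orbitConcat_add, add_comm,
        orbitConcat_add]
      exact List.prefix_append _ _
    have h2 := hpre m u hu
    have h3 := h2.length_le
    generalize orbitConcat V s a e = W at *
    generalize orbitConcat V s m e₁ = R at *
    generalize orbitConcat V s (q + 1) e₁ = P at *
    obtain ⟨v, hv⟩ := h2
    obtain ⟨w, hw⟩ := h1
    have e1 : ∀ j < u.length, u[j]? = (W ++ R)[j]? := fun j hj => by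
      rw [← hv, List.getElem?_append_left hj]
    have e2 : ∀ j < R.length, R[j]? = (P ++ R)[j]? := fun j hj => by
      rw [← hw, List.getElem?_append_left hj]
    rw [List.length_append] at h3
    rw [e1 i (by omega), e1 _ hlt, List.getElem?_append_right hi,
      List.getElem?_append_right (by omega), e2 (i + P.length - W.length) (by omega),
      List.getElem?_append_right (by omega)]
    congr 1
    omega

lemma prefix_append_cases {u v w : List A} (h : u <+: v ++ w) :
    u <+: v ∨ ∃ u', u = v ++ u' ∧ u' <+: w := by
  obtain ⟨t, ht⟩ := h
  rcases List.append_eq_append_iff.1 ht with ⟨as, rfl, _⟩ | ⟨bs, rfl, rfl⟩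
  · exact Or.inl (List.prefix_append _ _)
  · exact Or.inr ⟨bs, rfl, List.prefix_append _ _⟩

/-- Here `s a` is the first letter of `F a` that is not eventually fixed, and `V a` is the stable
image of the letters before it. A prefix of fixed letters cannot contain all of `F^m (s a)`, so it
stops before `V a` ends or continues inside `F^m (s a)`, where induction applies. -/
lemma prefix_orbitConcat {V : A → List A} {s : A → A} {M : ℕ}
    (hV : ∀ a, ¬ IsEventuallyFixed F a → ∃ u v, F a = u ++ s a :: v ∧
      (∀ c ∈ u, ∀ k, IsFixed F (pow F (k + M) c)) ∧ ¬ IsEventuallyFixed F (s a) ∧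
      V a = subst (pow F M) u)
    (m : ℕ) (a : A) (ha : ¬ IsEventuallyFixed F a) (u : List A) (hu : u <+: pow F m a)
    (hfix : IsFixed F u) : u <+: orbitConcat V s m a := by
  induction m generalizing a u with
  | zero =>
    rw [pow_zero_apply, List.prefix_cons_iff] at hu
    rcases hu with rfl | ⟨t, rfl, ht⟩
    · exact List.nil_prefix
    · rw [List.prefix_nil] at ht
      subst ht
      exact absurd ⟨0, hfix⟩ ha
  | succ m ih =>
    obtain ⟨p, v, hF, hp, hs, hVa⟩ := hV a ha
    rw [pow_add_apply, pow_one_eq, hF, subst_append, subst_cons] at hu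
    have hpM : ∀ k, subst (pow F (k + M)) p = subst (pow F M) p := fun k =>
      subst_congr fun c hc => by simpa using ((hp c hc 0).pow_add k)
    rw [orbitConcat, hVa]
    rcases prefix_append_cases hu with h | ⟨u', rfl, h⟩
    · have h1 := subst_prefix (pow F M) h
      rw [hfix.subst_pow, subst_subst] at h1
      simp only [subst_pow_pow] at h1
      rw [add_comm, hpM] at h1
      exact h1.trans (List.prefix_append _ _)
    · have h1 : subst (pow F m) p = subst (pow F M) p := by
        have : IsFixed F (subst (pow F m) p) := hfix.of_subset (by simp)
        rw [← this.subst_pow M, subst_subst]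
        simp only [subst_pow_pow]
        rw [add_comm, hpM]
      rw [h1, List.prefix_append_right_inj]
      have hfix' : IsFixed F u' := hfix.of_subset (by simp)
      rcases prefix_append_cases h with h | ⟨u'', rfl, h⟩
      · exact ih _ hs _ h hfix'
      · exact absurd ⟨m, hfix'.of_subset (by simp)⟩ hs

lemma exists_hasPeriodFrom_of_prefix_pow [Finite A] (hF : ∀ a, F a ≠ []) (a : A) :
    ∃ p N, 0 < p ∧ ∀ m u, u <+: pow F m a → IsFixed F u → HasPeriodFrom p N u := by
  by_cases ha : IsEventuallyFixed F a
  · obtain ⟨m, hm⟩ := ha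
    refine ⟨1, (pow F m a).length, one_pos, fun k u hu _ i hi hlt => ?_⟩
    have := hu.length_le.trans (length_pow_le hF hm k)
    omega
  · obtain ⟨M, hM⟩ := exists_isFixed_pow F
    have : ∀ a, ∃ b V, ¬ IsEventuallyFixed F a → ∃ u v, F a = u ++ b :: v ∧
        (∀ c ∈ u, ∀ k, IsFixed F (pow F (k + M) c)) ∧ ¬ IsEventuallyFixed F b ∧
        V = subst (pow F M) u := by
      intro a
      by_cases ha : IsEventuallyFixed F a
      · exact ⟨a, [], fun h => absurd ha h⟩
      · obtain ⟨u, b, v, h1, h2, h3⟩ := exists_split_of_not_isEventuallyFixed ha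
        exact ⟨b, subst (pow F M) u, fun _ => ⟨u, v, h1, fun c hc => hM c (h2 c hc), h3, rfl⟩⟩
    choose s V hV using this
    obtain ⟨p, N, hp, h⟩ := exists_hasPeriodFrom_orbitConcat V s a
    exact ⟨p, N, hp, fun m u hu hfix => h m u (prefix_orbitConcat hV m a ha u hu hfix)⟩

lemma subst_reverse (w : List A) :
    subst (fun a => (F a).reverse) w.reverse = (subst F w).reverse := by
  induction w with
  | nil => rfl
  | cons a w ih => simp [ih]

lemma pow_reverse (m : ℕ) (a : A) :
    pow (fun a => (F a).reverse) m a = (pow F m a).reverse := by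
  induction m with
  | zero => rfl
  | succ m ih =>
    rw [add_comm, pow_add_apply, pow_add_apply, ih, pow_one_eq, pow_one_eq, subst_reverse]

/-- Uniform periodicity of the words of fixed letters at both ends of the words `F^m(a)`. -/
lemma exists_hasPeriodFrom_uniform [Finite A] (hF : ∀ a, F a ≠ []) :
    ∃ p N, 0 < p ∧ ∀ a m u, IsFixed F u → (u <+: pow F m a → HasPeriodFrom p N u) ∧
      (u <:+ pow F m a → HasPeriodFrom p N u.reverse) := by
  choose p N hp h using fun a => exists_hasPeriodFrom_of_prefix_pow hF a
  -- Suffixes become prefixes for the morphism with reversed letter images.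
  choose p' N' hp' h' using fun a => exists_hasPeriodFrom_of_prefix_pow
    (F := fun a => (F a).reverse) (by simpa using hF) a
  cases nonempty_fintype A
  have hle : ∀ (f : A → ℕ) a, f a ≤ ∑ a, f a := fun f a =>
    Finset.single_le_sum (fun _ _ => Nat.zero_le _) (Finset.mem_univ a)
  refine ⟨(∏ a, p a) * ∏ a, p' a, (∑ a, N a) + ∑ a, N' a,
    Nat.mul_pos (Finset.prod_pos fun a _ => hp a) (Finset.prod_pos fun a _ => hp' a),
    fun a m u hfix => ⟨fun hu => ?_, fun hu => ?_⟩⟩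
  · exact (h a m u hu hfix).mono ((Finset.dvd_prod_of_mem p (Finset.mem_univ a)).mul_right _)
      ((hle N a).trans (Nat.le_add_right _ _))
  · refine (h' a m u.reverse ?_ ?_).mono
      ((Finset.dvd_prod_of_mem p' (Finset.mem_univ a)).mul_left _)
      ((hle N' a).trans (Nat.le_add_left _ _))
    · rw [pow_reverse]
      exact List.reverse_prefix.2 hu
    · intro b hb
      simp [hfix b (by simpa using hb)]

lemma prefix_subst_cases {φ : A → List A} {L w : List A} (hw : w ≠ []) (h : w <+: subst φ L) :
    ∃ r b, r ++ [b] <+: L ∧ ∃ β, w = subst φ r ++ β ∧ β <+: φ b := by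
  induction L generalizing w with
  | nil => simp [hw] at h
  | cons a L ih =>
    rw [subst_cons] at h
    rcases prefix_append_cases h with h' | ⟨w', rfl, h'⟩
    · exact ⟨[], a, by simp, w, rfl, h'⟩
    · by_cases hw' : w' = []
      · subst hw'
        exact ⟨[], a, by simp, φ a, by simp, List.prefix_refl _⟩
      · obtain ⟨r, b, h1, β, rfl, h2⟩ := ih hw' h'
        exact ⟨a :: r, b, by simpa using h1, β, by simp, h2⟩

lemma infix_subst_cases {φ : A → List A} {L w : List A} (hw : w ≠ []) (h : w <:+: subst φ L) :
    (∃ a ∈ L, w <:+: φ a) ∨ ∃ a r b, a :: (r ++ [b]) <:+: L ∧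
      ∃ α β, w = α ++ (subst φ r ++ β) ∧ α <:+ φ a ∧ β <+: φ b := by
  induction L with
  | nil => simp [hw] at h
  | cons a L ih =>
    rw [subst_cons] at h
    by_cases hL : w <:+: subst φ L
    · rcases ih hL with ⟨b, hb, h⟩ | ⟨b, r, c, h1, h2⟩
      · exact Or.inl ⟨b, by simp [hb], h⟩
      · exact Or.inr ⟨b, r, c, h1.trans (List.suffix_cons a L).isInfix, h2⟩
    · obtain ⟨t, ht, hwt⟩ := List.infix_iff_prefix_suffix.1 h
      obtain ⟨s, hs⟩ := hwt
      rcases List.append_eq_append_iff.1 hs with ⟨t', hφ, rfl⟩ | ⟨t', rfl, ht'⟩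
      · rcases prefix_append_cases ht with h' | ⟨w', rfl, h'⟩
        · exact Or.inl ⟨a, by simp, hφ ▸ h'.isInfix.trans (List.suffix_append _ _).isInfix⟩
        · by_cases hw' : w' = []
          · subst hw'
            exact Or.inl ⟨a, by simp, by simpa [hφ] using (List.suffix_append s t').isInfix⟩
          · obtain ⟨r, b, h1, β, rfl, h2⟩ := prefix_subst_cases hw' h'
            refine Or.inr ⟨a, r, b, ?_, t', β, rfl, hφ ▸ List.suffix_append _ _, h2⟩
            exact ((List.prefix_cons_inj a).2 h1).isInfix
      · exact absurd (ht.isInfix.trans (ht' ▸ (List.suffix_append _ _).isInfix)) hL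

/-- Descend through the powers until `w` no longer fits in the image of one letter. Two letters
never fit at level zero, so this happens. -/
lemma infix_pow_cases {F : A → List A} {w : List A} (hw : 2 ≤ w.length) {m : ℕ} {a : A}
    (h : w <:+: pow F m a) : ∃ c m' b r b', b :: (r ++ [b']) <:+: F c ∧
      ∃ α β, w = α ++ (subst (pow F m') r ++ β) ∧ α <:+ pow F m' b ∧ β <+: pow F m' b' := by
  induction m generalizing a with
  | zero => have := h.length_le; simp at this; omega
  | succ m ih =>
    rw [pow_add_apply, pow_one_eq] at h
    have hw0 : w ≠ [] := by rintro rfl; simp at hw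
    rcases infix_subst_cases hw0 h with ⟨b, _, h⟩ | ⟨b, r, b', h1, h2⟩
    · exact ih h
    · exact ⟨a, m, b, r, b', h1, h2⟩

/-- Lengths of iterates of an eventually fixed letter never exceed the stable length, and `r` lies
in one of finitely many words `F c`. -/
lemma exists_length_subst_pow_le [Finite A] (hF : ∀ a, F a ≠ []) :
    ∃ K, ∀ c r m, r <:+: F c → IsFixed F (subst (pow F m) r) →
      (subst (pow F m) r).length ≤ K := by
  have : ∀ a, ∃ k, ∀ m, IsFixed F (pow F m a) → (pow F m a).length ≤ k := by
    intro a
    by_cases h : ∃ m, IsFixed F (pow F m a)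
    · obtain ⟨m, hm⟩ := h
      exact ⟨_, fun k _ => length_pow_le hF hm k⟩
    · exact ⟨0, fun m hm => absurd ⟨m, hm⟩ h⟩
  choose k hk using this
  have hsum : ∀ (r : List A) m, IsFixed F (subst (pow F m) r) →
      (subst (pow F m) r).length ≤ (r.map k).sum := by
    intro r m h
    induction r with
    | nil => simp
    | cons a r ih =>
      rw [subst_cons] at h
      have h1 := ih (h.of_subset (by simp))
      have h2 := hk a m (h.of_subset (by simp))
      simp; omega
  cases nonempty_fintype A
  refine ⟨∑ c, ((F c).map k).sum, fun c r m hr h => (hsum r m h).trans ?_⟩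
  have h1 : (r.map k).sum ≤ ((F c).map k).sum := by
    obtain ⟨s, t, hst⟩ := hr
    rw [← hst]
    simp; omega
  exact h1.trans (Finset.single_le_sum (f := fun c => ((F c).map k).sum)
    (fun _ _ => Nat.zero_le _) (Finset.mem_univ c))

/-- An infinite word of fixed letters all of whose factors occur in words `F^m(a)` is ultimately
periodic. -/
lemma eventually_periodic_of_forall_fixed [Finite A] (hF : ∀ a, F a ≠ []) {t : ℕ → A}
    (ht : ∀ i, F (t i) = [t i]) (h : ∀ n, ∃ m a, take t n <:+: pow F m a) :
    ∃ p N, 0 < p ∧ ∀ i, N ≤ i → t i = t (i + p) := by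
  obtain ⟨p, N, hp, hper⟩ := exists_hasPeriodFrom_uniform hF
  obtain ⟨K, hK⟩ := exists_length_subst_pow_le hF
  -- Here `j` is the length of the left part `α`. The period can fail only in a window of bounded
  -- size around `j`.
  have key : ∀ n, ∃ j ≤ n + 2, ∀ i, i + p < n + 2 → (i + p + N < j ∨ j + K + N ≤ i) →
      t i = t (i + p) := by
    intro n
    obtain ⟨m, a, hm⟩ := h (n + 2)
    obtain ⟨c, m', b, r, b', hc, α, β, hw, hα, hβ⟩ := infix_pow_cases (by simp) hm
    have hfix : IsFixed F (take t (n + 2)) := by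
      intro a ha
      simp only [take, List.mem_map] at ha
      obtain ⟨i, _, rfl⟩ := ha
      exact ht i
    have hlen := congrArg List.length hw
    simp only [length_take, List.length_append] at hlen
    have hr : (subst (pow F m') r).length ≤ K := by
      refine hK c r m' ?_ (hfix.of_subset (by simp [hw]))
      exact List.IsInfix.trans ⟨[b], [b'], by simp⟩ hc
    have hget : ∀ i < n + 2, some (t i) = (α ++ (subst (pow F m') r ++ β))[i]? := by
      intro i hi
      rw [← hw, List.getElem?_eq_getElem (by simpa using hi), getElem_take]
    have hα' := (hper b m' α (hfix.of_subset (by simp [hw]))).2 hα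
    have hβ' := (hper b' m' β (hfix.of_subset (by simp [hw]))).1 hβ
    refine ⟨α.length, by omega, fun i hi hij => Option.some_injective _ ?_⟩
    rw [hget i (by omega), hget _ hi]
    rcases hij with hij | hij
    · rw [List.getElem?_append_left (by omega), List.getElem?_append_left (by omega)]
      have := hα' (α.length - 1 - (i + p)) (by omega) (by simp; omega)
      rw [List.getElem?_reverse' (j := i + p) (by omega),
        List.getElem?_reverse' (j := i) (by omega)] at this
      exact this.symm
    · rw [← List.append_assoc, List.getElem?_append_right (by simp; omega),
        List.getElem?_append_right (by simp; omega)]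
      simp only [List.length_append]
      rw [hβ' _ (by omega) (by omega)]
      congr 1
      omega
  choose j hjn hj using key
  -- If the windows stay bounded, the period holds beyond them. Otherwise they escape to infinity
  -- and it holds everywhere.
  by_cases hb : ∃ J, ∀ n, j n ≤ J
  · obtain ⟨J, hJ⟩ := hb
    exact ⟨p, J + K + N, hp, fun i hi => hj (i + p) i (by omega)
      (Or.inr (by have := hJ (i + p); omega))⟩
  · push Not at hb
    refine ⟨p, 0, hp, fun i _ => ?_⟩
    obtain ⟨n, hn⟩ := hb (i + p + N)
    have := hjn n
    exact hj n i (by omega) (Or.inl hn)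

end MorphicWords

namespace MorphicWords

/-! ### Desubstitution in the shift orbit closure. -/

variable {A : Type*} {φ : A → List A} {x : ℕ → A}

lemma mem_orbitClosure_iff {y : ℕ → A} :
    y ∈ orbitClosure x ↔ ∀ n, ∃ i, take y n = take (shift i x) n := by
  constructor
  · intro h n
    obtain ⟨i, m, hm⟩ := h (⟨0, n, by simp⟩ : take y n ∈ factors y)
    have := congrArg List.length hm
    simp only [length_take] at this
    subst this
    exact ⟨i, hm⟩
  · rintro h _ ⟨i, n, rfl⟩
    obtain ⟨k, hk⟩ := h (i + n)
    refine ⟨k + i, n, take_eq_take_iff.2 fun j hj => ?_⟩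
    rw [add_assoc]
    exact take_eq_take_iff.1 hk (i + j) (by omega)

lemma self_mem_orbitClosure : x ∈ orbitClosure x :=
  fun _ h => h

lemma shift_mem_orbitClosure {y : ℕ → A} (hy : y ∈ orbitClosure x) (k : ℕ) :
    shift k y ∈ orbitClosure x := by
  rintro _ ⟨i, n, rfl⟩
  refine hy ⟨k + i, n, ?_⟩
  simp only [shift, add_assoc]

lemma img_mem_orbitClosure (hφ : ∀ a, φ a ≠ []) (hx : img φ x = x) {y : ℕ → A}
    (hy : y ∈ orbitClosure x) : img φ y ∈ orbitClosure x := by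
  rw [mem_orbitClosure_iff] at hy ⊢
  intro n
  obtain ⟨i, hi⟩ := hy n
  exact ⟨(subst φ (take x i)).length, by rw [img_congr hi, img_shift hφ, hx]⟩

lemma img_pow_mem_orbitClosure (hφ : ∀ a, φ a ≠ []) (hx : img φ x = x) {y : ℕ → A}
    (hy : y ∈ orbitClosure x) (k : ℕ) : img (pow φ k) y ∈ orbitClosure x := by
  refine img_mem_orbitClosure (pow_ne_nil hφ k) ?_ hy
  induction k with
  | zero =>
    symm
    refine eq_img (by simp) fun n => ?_
    have : pow φ 0 = fun a => [a] := rfl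
    rw [this, subst_singleton]
    exact isPrefixOf_take x n
  | succ k ih => rw [← img_pow_img_pow hφ, pow_one_eq, hx, ih]

lemma exists_shift_eq_shift_img (hφ : ∀ a, φ a ≠ []) (hx : img φ x = x) (i : ℕ) :
    ∃ l j, j < (φ (x l)).length ∧ shift i x = shift j (img φ (shift l x)) := by
  induction i with
  | zero => exact ⟨0, 0, List.length_pos_iff.2 (hφ _), by simp [hx]⟩
  | succ i ih =>
    obtain ⟨l, j, hj, h⟩ := ih
    rw [← shift_shift, h, shift_shift]
    rcases Nat.lt_or_ge (j + 1) (φ (x l)).length with h1 | h1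
    · exact ⟨l, j + 1, h1, rfl⟩
    · refine ⟨l + 1, 0, List.length_pos_iff.2 (hφ _), ?_⟩
      rw [show j + 1 = (φ (x l)).length by omega, shift_zero, ← shift_shift]
      exact img_shift_one hφ (shift l x)

open Filter in
lemma exists_eventually_eq_hyperfilter {B : Type*} [Finite B] (u : ℕ → B) :
    ∃ v, ∀ᶠ n in (hyperfilter ℕ : Filter ℕ), u n = v := by
  by_contra! h
  obtain ⟨n, hn⟩ := (eventually_all.2 h).exists
  exact hn _ rfl

/-- Desubstitution of the words in the shift orbit closure of a fixed point. -/
lemma exists_eq_shift_img [Finite A] (hφ : ∀ a, φ a ≠ []) (hx : img φ x = x) {y : ℕ → A}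
    (hy : y ∈ orbitClosure x) :
    ∃ y' ∈ orbitClosure x, ∃ j < (φ (y' 0)).length, y = shift j (img φ y') := by
  rw [mem_orbitClosure_iff] at hy
  have : ∀ n, ∃ l j, j < (φ (x l)).length ∧ take y n = take (shift j (img φ (shift l x))) n := by
    intro n
    obtain ⟨i, hi⟩ := hy n
    obtain ⟨l, j, hj, h⟩ := exists_shift_eq_shift_img hφ hx i
    exact ⟨l, j, hj, by rw [hi, h]⟩
  choose l j hj hlj using this
  -- Compactness: the preimages of longer and longer prefixes of `y` converge letter by letter along
  -- a nonprincipal ultrafilter. The offsets, being bounded, become constant along it.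
  choose y' hy' using fun i => exists_eventually_eq_hyperfilter fun n => shift (l n) x i
  have htake : ∀ m, ∀ᶠ n in (Filter.hyperfilter ℕ : Filter ℕ),
      take (shift (l n) x) m = take y' m := by
    intro m
    simp only [take_eq_take_iff]
    exact (Filter.eventually_all_finite (Set.finite_lt_nat m)).2 fun i _ => hy' i
  have hbound : ∃ M, ∀ a, (φ a).length < M := by
    cases nonempty_fintype A
    refine ⟨(∑ a, (φ a).length) + 1, fun a => Nat.lt_succ_of_le ?_⟩
    exact Finset.single_le_sum (f := fun a => (φ a).length) (fun _ _ => Nat.zero_le _)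
      (Finset.mem_univ a)
  obtain ⟨M, hM⟩ := hbound
  obtain ⟨⟨J, _⟩, hJ⟩ := exists_eventually_eq_hyperfilter
    fun n => (⟨j n, (hj n).trans (hM _)⟩ : Fin M)
  simp only [Fin.mk.injEq] at hJ
  refine ⟨y', mem_orbitClosure_iff.2 fun n => ?_, J, ?_, eq_of_forall_take fun n => ?_⟩
  · obtain ⟨k, hk⟩ := (htake n).exists
    exact ⟨l k, hk.symm⟩
  · obtain ⟨k, hk, rfl⟩ := ((hy' 0).and hJ).exists
    rw [← hk]
    exact hj k
  · obtain ⟨k, ⟨hk, rfl⟩, hn⟩ := (((htake (J + n)).and hJ).and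
      (Nat.hyperfilter_le_atTop (Filter.eventually_ge_atTop n))).exists
    have h1 := take_eq_take_iff.1 (img_congr (φ := φ) hk)
    have h2 := take_eq_take_iff.1 (hlj k)
    exact take_eq_take_iff.2 fun i hi => (h2 i (by omega)).trans (h1 (j k + i) (by omega))

/-! ### Lexicographic order and minimal words. -/

section order

variable {σ : A → A → Prop}

lemma LexLT.of_shift {y z : ℕ → A} {k : ℕ} (h : take y k = take z k)
    (hlt : LexLT σ (shift k y) (shift k z)) : LexLT σ y z := by
  obtain ⟨i, hi, hσ⟩ := hlt
  refine ⟨k + i, fun j hj => ?_, hσ⟩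
  rcases Nat.lt_or_ge j k with hjk | hjk
  · exact take_eq_take_iff.1 h j hjk
  · have := hi (j - k) (by omega)
    simpa [shift, Nat.add_sub_cancel' hjk] using this

lemma LexLT.shift [Std.Asymm σ] {y z : ℕ → A} {k : ℕ} (h : take y k = take z k)
    (hlt : LexLT σ y z) : LexLT σ (shift k y) (MorphicWords.shift k z) := by
  obtain ⟨i, hi, hσ⟩ := hlt
  rcases Nat.lt_or_ge i k with hik | hik
  · rw [take_eq_take_iff.1 h i hik] at hσ
    exact absurd hσ (Std.Asymm.asymm _ _ hσ)
  · refine ⟨i - k, fun j hj => hi _ (by omega), ?_⟩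
    simpa [MorphicWords.shift, Nat.add_sub_cancel' hik] using hσ

lemma lexLT_of_list_lex {u v : List A} (h : List.Lex σ u v) (huv : ¬ u <+: v) {y z : ℕ → A}
    (hu : IsPrefixOf u y) (hv : IsPrefixOf v z) : LexLT σ y z := by
  induction h generalizing y z with
  | nil => exact absurd List.nil_prefix huv
  | rel h =>
    rw [isPrefixOf_cons] at hu hv
    exact ⟨0, fun j hj => absurd hj (Nat.not_lt_zero j), hu.1 ▸ hv.1 ▸ h⟩
  | cons h ih =>
    rw [isPrefixOf_cons] at hu hv
    refine LexLT.of_shift (k := 1) ?_ (ih (fun h' => huv ?_) hu.2 hv.2)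
    · rw [take_one, take_one, ← hu.1, ← hv.1]
    · exact (List.prefix_cons_inj _).2 h'

lemma lexLT_trichotomy [Std.Trichotomous σ] (y z : ℕ → A) :
    y = z ∨ LexLT σ y z ∨ LexLT σ z y := by
  by_cases h : y = z
  · exact Or.inl h
  classical
  have h' : ∃ i, y i ≠ z i := Function.ne_iff.1 h
  have hmin : ∀ j < Nat.find h', y j = z j := fun j hj => not_not.1 (Nat.find_min h' hj)
  by_cases h1 : σ (y (Nat.find h')) (z (Nat.find h'))
  · exact Or.inr (Or.inl ⟨_, hmin, h1⟩)
  · by_cases h2 : σ (z (Nat.find h')) (y (Nat.find h'))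
    · exact Or.inr (Or.inr ⟨_, fun j hj => (hmin j hj).symm, h2⟩)
    · exact absurd (Std.Trichotomous.trichotomous _ _ h1 h2) (Nat.find_spec h')

/-- The word `y` is minimal among the words of the orbit closure of `x` with the same first
letter. -/
def IsMinimalIn (x : ℕ → A) (σ : A → A → Prop) (y : ℕ → A) : Prop :=
  y ∈ orbitClosure x ∧ ∀ z ∈ orbitClosure x, z 0 = y 0 → ¬ LexLT σ z y

lemma IsMinimalIn.eq [Std.Trichotomous σ] {y z : ℕ → A} (hy : IsMinimalIn x σ y)
    (hz : IsMinimalIn x σ z) (h : y 0 = z 0) : y = z := by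
  rcases lexLT_trichotomy (σ := σ) y z with h' | h' | h'
  · exact h'
  · exact absurd h' (hz.2 y hy.1 h)
  · exact absurd h' (hy.2 z hz.1 h.symm)

/-- At the first difference the two images begin with prefix-incomparable words of `p`, whose
comparison decides the order of the images. -/
lemma lexLT_img [Std.Asymm σ] (hφ : ∀ a, φ a ≠ []) {p : A → List A}
    (hp : ∀ y ∈ orbitClosure x, IsPrefixOf (p (y 0)) (img φ y))
    (hpp : ∀ a b, a ≠ b → ¬ p a <+: p b) {y z : ℕ → A} (hy : y ∈ orbitClosure x)
    (hz : z ∈ orbitClosure x) (h : LexLT (fun a b => List.Lex σ (p a) (p b)) y z) :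
    LexLT σ (img φ y) (img φ z) := by
  obtain ⟨i, hi, hlex⟩ := h
  have hne : y i ≠ z i := by
    intro h
    simp only [h] at hlex
    exact (asymm hlex : ¬ List.Lex σ (p (z i)) (p (z i))) hlex
  have h1 := lexLT_of_list_lex hlex (hpp _ _ hne) (hp _ (shift_mem_orbitClosure hy i))
    (hp _ (shift_mem_orbitClosure hz i))
  have htake : take y i = take z i := take_eq_take_iff.2 hi
  rw [img_shift hφ, img_shift hφ, htake] at h1
  refine h1.of_shift ?_
  have h2 := isPrefixOf_subst_take hφ y i
  have h3 := isPrefixOf_subst_take hφ z i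
  rw [htake] at h2
  exact Eq.trans h2 h3.symm

/-- A smaller competitor of `y'` with the same first letter has a smaller image agreeing on the
whole first block, hence beyond the cut `j`. Shifting by `j` would beat `y`. -/
lemma exists_isMinimalIn_desubst [Finite A] [Std.Asymm σ] (hφ : ∀ a, φ a ≠ [])
    (hx : img φ x = x) {p : A → List A}
    (hp : ∀ y ∈ orbitClosure x, IsPrefixOf (p (y 0)) (img φ y))
    (hpp : ∀ a b, a ≠ b → ¬ p a <+: p b) {y : ℕ → A} (hy : IsMinimalIn x σ y) :
    ∃ y', IsMinimalIn x (fun a b => List.Lex σ (p a) (p b)) y' ∧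
      ∃ j < (φ (y' 0)).length, y = shift j (img φ y') := by
  obtain ⟨y', hy', j, hj, rfl⟩ := exists_eq_shift_img hφ hx hy.1
  refine ⟨y', ⟨hy', fun z hz hz0 hlt => ?_⟩, j, hj, rfl⟩
  have h1 := isPrefixOf_img_zero hφ z
  have h2 := isPrefixOf_img_zero hφ y'
  rw [hz0] at h1
  have h3 : ∀ i < (φ (y' 0)).length, img φ z i = img φ y' i :=
    take_eq_take_iff.1 (Eq.trans h1 h2.symm)
  refine hy.2 (shift j (img φ z)) (shift_mem_orbitClosure (img_mem_orbitClosure hφ hx hz) j)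
    (h3 j hj) ?_
  exact (lexLT_img hφ hp hpp hz hy' hlt).shift
    (take_eq_take_iff.2 fun i hi => h3 i (hi.trans hj))

end order

/-! ### Cycles of desubstitution and the resulting morphic words. -/

/-- The word `y` is a suffix of the image of `y'` under the `k`-th power of `φ`, starting inside
the image of the first letter. -/
def IsDesubst (φ : A → List A) (k : ℕ) (y y' : ℕ → A) : Prop :=
  ∃ j < (pow φ k (y' 0)).length, y = shift j (img (pow φ k) y')

lemma isDesubst_zero (y : ℕ → A) : IsDesubst φ 0 y y := by
  refine ⟨0, by simp, ?_⟩
  rw [shift_zero]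
  refine eq_img (by simp) fun n => ?_
  rw [show pow φ 0 = fun a => [a] from rfl, subst_singleton]
  exact isPrefixOf_take y n

lemma IsDesubst.trans (hφ : ∀ a, φ a ≠ []) {k l : ℕ} {y y' y'' : ℕ → A}
    (h : IsDesubst φ k y y') (h' : IsDesubst φ l y' y'') : IsDesubst φ (k + l) y y'' := by
  obtain ⟨j, hj, rfl⟩ := h
  obtain ⟨i, hi, rfl⟩ := h'
  refine ⟨(subst (pow φ k) (take (img (pow φ l) y'') i)).length + j, ?_, ?_⟩
  · have h1 : take (img (pow φ l) y'') (i + 1) <+: pow φ l (y'' 0) :=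
      (isPrefixOf_take _ _).prefix_of_le (isPrefixOf_img_zero (pow_ne_nil hφ l) y'') (by simpa)
    have h2 := (subst_prefix (pow φ k) h1).length_le
    rw [subst_pow_pow, take_succ', subst_append, List.length_append] at h2
    refine lt_of_lt_of_le (Nat.add_lt_add_left ?_ _) h2
    simpa [shift] using hj
  · rw [img_shift (pow_ne_nil hφ k), shift_shift, img_pow_img_pow hφ]

/-- Minimal words are obtained from a periodic point of desubstitution. -/
lemma exists_isDesubst_self [Finite A] (hφ : ∀ a, φ a ≠ []) (hx : img φ x = x) {p : A → List A}
    (hp : ∀ y ∈ orbitClosure x, IsPrefixOf (p (y 0)) (img φ y))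
    (hpp : ∀ a b, a ≠ b → ¬ p a <+: p b) {σ : A → A → Prop} [Std.Asymm σ] [Std.Trichotomous σ]
    {y : ℕ → A} (hy : IsMinimalIn x σ y) :
    ∃ s ∈ orbitClosure x, ∃ m k, 0 < k ∧ IsDesubst φ m y s ∧ IsDesubst φ k s s := by
  -- Transitivity of the orders is not carried along: asymmetry serves the desubstitution step,
  -- trichotomy the uniqueness of minimal words.
  let State := {s : (A → A → Prop) × (ℕ → A) //
    Std.Asymm s.1 ∧ Std.Trichotomous s.1 ∧ IsMinimalIn x s.1 s.2}
  have step : ∀ s : State, ∃ s' : State, IsDesubst φ 1 s.1.2 s'.1.2 := by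
    rintro ⟨⟨τ, z⟩, hτ, hτ', hz⟩
    obtain ⟨y', hy', h⟩ := exists_isMinimalIn_desubst hφ hx hp hpp hz
    refine ⟨⟨⟨_, y'⟩, ?_, ?_, hy'⟩, ?_⟩
    · exact ⟨fun a b (h : List.Lex τ (p a) (p b)) => (asymm h : ¬ List.Lex τ (p b) (p a))⟩
    · refine ⟨fun a b h1 h2 => ?_⟩
      have := Std.Trichotomous.trichotomous (r := List.Lex τ) _ _ h1 h2
      by_contra hab
      exact hpp a b hab (this ▸ List.prefix_refl _)
    · rwa [IsDesubst, pow_one_eq]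
  choose next hnext using step
  let s : ℕ → State := fun n => next^[n] ⟨⟨σ, y⟩, inferInstance, inferInstance, hy⟩
  have hs : ∀ m k, IsDesubst φ k (s m).1.2 (s (m + k)).1.2 := by
    intro m k
    induction k with
    | zero => exact isDesubst_zero _
    | succ k ih =>
      have := ih.trans hφ (hnext (s (m + k)))
      simpa only [s, ← add_assoc, Function.iterate_succ_apply'] using this
  -- Pigeonhole on the finitely many pairs of a relation and a first letter.
  obtain ⟨a, b, hab, h⟩ := Finite.exists_ne_map_eq_of_infinite
    fun n => ((s n).1.1, (s n).1.2 0)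
  wlog hlt : a < b generalizing a b
  · exact this b a hab.symm h.symm (by omega)
  obtain ⟨k, rfl⟩ := Nat.exists_eq_add_of_lt hlt
  have heq : (s a).1.2 = (s (a + k + 1)).1.2 := by
    obtain ⟨h1, h2⟩ := Prod.mk.inj h
    have := (s a).2.2.1
    refine (s a).2.2.2.eq ?_ h2
    rw [h1]
    exact (s (a + k + 1)).2.2.2
  refine ⟨(s a).1.2, (s a).2.2.2.1, a, k + 1, by omega, ?_, ?_⟩
  · have := hs 0 a
    rwa [zero_add] at this
  · have := hs a (k + 1)
    rwa [← add_assoc, ← heq] at this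

lemma isMorphic_of_shift_eq_img [Finite A] {F : A → List A} (hF : ∀ a, F a ≠ []) {y t : ℕ → A}
    {k : ℕ} (hy : shift (k + 1) y = t) (ht : img F t = t)
    (hfac : ∀ n, ∃ m a, take t n <:+: pow F m a) : IsMorphic y := by
  classical
  by_cases hfix : ∀ i, F (t i) = [t i]
  · obtain ⟨p, N, hp, h⟩ := eventually_periodic_of_forall_fixed hF hfix hfac
    refine isMorphic_of_eventually_periodic (p := p) (N := k + 1 + N) hp fun i hi => ?_
    have := h (i - (k + 1)) (by omega)
    rw [← hy] at this
    simp only [shift] at this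
    convert this using 2 <;> omega
  · push Not at hfix
    -- The letters before the first non-fixed one reproduce themselves, so the suffix starting at
    -- `i` is still a fixed point of `F`.
    obtain ⟨i, hi, hmin⟩ : ∃ i, F (t i) ≠ [t i] ∧ ∀ j < i, F (t j) = [t j] :=
      ⟨Nat.find hfix, Nat.find_spec hfix, fun j hj => not_not.1 (Nat.find_min hfix hj)⟩
    have hsub : subst F (take t i) = take t i := by
      refine subst_eq_self fun a ha => ?_
      simp only [take, List.mem_map, List.mem_range] at ha
      obtain ⟨j, hj, rfl⟩ := ha
      exact hmin j hj
    have hi' : img F (shift i t) = shift i t := by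
      rw [img_shift hF, hsub, ht, length_take]
    have hpre := isPrefixOf_img_zero hF (shift i t)
    have hshift := img_shift_one hF (shift i t)
    rw [hi'] at hpre hshift
    have h0 : shift i t 0 = t i := rfl
    rw [h0] at hpre hshift
    obtain ⟨b, w, hw⟩ := List.exists_cons_of_ne_nil (hF (t i))
    rw [hw] at hpre hshift hi
    rw [isPrefixOf_cons] at hpre
    have hb : b = t i := hpre.1
    refine isMorphic_of_isSubstSeries_shift (k := k + 1 + i) ?_
    have : shift (k + 1 + i + 1) y = shift 1 (shift i t) := by
      rw [← hy, shift_shift, shift_shift, add_assoc]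
    rw [this]
    refine isSubstSeries_of_shift_eq_img hF (w := w) ?_ hpre.2 ?_
    · rintro rfl
      exact hi (by rw [hb])
    · rw [shift_shift, ← hshift, List.length_cons, add_comm]

lemma isMorphic_of_isDesubst_self [Finite A] (hφ : ∀ a, φ a ≠ []) (hx : img φ x = x)
    {m k : ℕ} {y s : ℕ → A} (hs : s ∈ orbitClosure x) (hys : IsDesubst φ m y s)
    (hss : IsDesubst φ k s s)
    (hfac : ∀ t ∈ orbitClosure x, ∀ n, ∃ m a, take t n <:+: pow (pow φ k) m a) :
    IsMorphic y := by
  have hF := pow_ne_nil hφ k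
  have hH := pow_ne_nil hφ m
  obtain ⟨j, hj, hy⟩ := hys
  obtain ⟨i, hi, hsi⟩ := hss
  -- `w` is the part of `F (s 0)` after the occurrence of `s 0` at position `i`.
  obtain ⟨w, hw, hwlen⟩ : ∃ w, IsPrefixOf w (shift 1 s) ∧
      i + 1 + w.length = (pow φ k (s 0)).length := by
    refine ⟨(pow φ k (s 0)).drop (i + 1), ?_, by simp; omega⟩
    have := isPrefixOf_img_zero hF s
    rw [← List.take_append_drop (i + 1) (pow φ k (s 0)), isPrefixOf_append,
      List.length_take_of_le hi] at this
    rw [hsi, shift_shift, ← hsi]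
    exact this.2
  have hst : shift w.length (shift 1 s) = img (pow φ k) (shift 1 s) := by
    rw [← img_shift_one hF, ← hwlen]
    conv_lhs => rw [hsi]
    rw [shift_shift, shift_shift, add_assoc]
  have hyt : ∃ l, shift (l + 1) y = img (pow φ m) (shift 1 s) := by
    refine ⟨(pow φ m (s 0)).length - j - 1, ?_⟩
    rw [hy, shift_shift, ← img_shift_one hH]
    congr 1
    omega
  obtain ⟨l, hl⟩ := hyt
  have hpre : IsPrefixOf (subst (pow φ m) w) (shift (l + 1) y) := hl ▸ hw.subst hH
  -- Powers of `φ` commute, so `φ^m` carries the series equation for `s` to one for a tail of `y`.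
  have hser : shift (subst (pow φ m) w).length (shift (l + 1) y) =
      img (pow φ k) (shift (l + 1) y) := by
    have := img_shift hH (shift 1 s) w.length
    rw [show take (shift 1 s) w.length = w from hw, hst, img_pow_img_pow hφ, add_comm,
      ← img_pow_img_pow hφ, ← hl] at this
    exact this.symm
  by_cases hw0 : w = []
  · subst hw0
    refine isMorphic_of_shift_eq_img hF rfl (by simpa using hser.symm) (hfac _ ?_)
    rw [hl]
    exact img_pow_mem_orbitClosure hφ hx (shift_mem_orbitClosure hs 1) m
  · exact isMorphic_of_isSubstSeries_shift
      (isSubstSeries_of_shift_eq_img hF (subst_ne_nil hH hw0) hpre hser)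

/-- If `x i` is erased, the suffixes at `i` and `i + 1` have the same image, so their words in `p`
are comparable and the two letters agree. Inductively `x` is constant from `i` on, and that suffix
has empty image, contradicting `hp0`. -/
lemma ne_nil_of_memM {p : A → List A} (hp0 : ∀ b, p b ≠ [])
    (hp : ∀ y ∈ orbitClosure x, ∃ n, p (y 0) <+: subst φ (take y n))
    (hpp : ∀ a b, a ≠ b → ¬ p a <+: p b) (i : ℕ) : φ (x i) ≠ [] := by
  intro h
  have hmem := fun k => shift_mem_orbitClosure (self_mem_orbitClosure (x := x)) k
  have hconst : ∀ k, x (i + k) = x i := by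
    intro k
    induction k with
    | zero => rfl
    | succ k ih =>
      obtain ⟨n, hn⟩ := hp _ (hmem (i + k))
      obtain ⟨m, hm⟩ := hp _ (hmem (i + k + 1))
      have h1 : p (x i) <+: subst φ (take (shift (i + k + 1) x) n) := by
        have h2 := hn.trans (subst_prefix φ (take_prefix_take _ (Nat.le_succ n)))
        rw [take_succ, subst_cons, shift_shift] at h2
        simpa [shift, ih, h] using h2
      have h3 := h1.trans (subst_prefix φ (take_prefix_take _ (le_max_left n m)))
      have h4 := hm.trans (subst_prefix φ (take_prefix_take _ (le_max_right n m)))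
      by_contra hne
      rcases List.prefix_or_prefix_of_prefix h3 h4 with h5 | h5
      · exact hpp _ _ (Ne.symm hne) h5
      · exact hpp _ _ hne h5
  obtain ⟨n, hn⟩ := hp _ (hmem i)
  have : subst φ (take (shift i x) n) = [] := by
    rw [subst, List.flatMap_eq_nil_iff]
    intro a ha
    simp only [take, List.mem_map, shift] at ha
    obtain ⟨k, _, rfl⟩ := ha
    rw [hconst, h]
  rw [this, List.prefix_nil] at hn
  exact hp0 _ hn

lemma exists_eq_of_mem_orbitClosure {y : ℕ → A} (hy : y ∈ orbitClosure x) (i : ℕ) :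
    ∃ j, y i = x j := by
  obtain ⟨k, hk⟩ := mem_orbitClosure_iff.1 hy (i + 1)
  exact ⟨k + i, take_eq_take_iff.1 hk i (by omega)⟩

lemma length_pow_ge (hφ : ∀ a, φ a ≠ []) {a : A} {u : List A} (hu : u ≠ [])
    (ha : φ a = a :: u) (n : ℕ) : n ≤ (pow φ n a).length := by
  induction n with
  | zero => simp
  | succ n ih =>
    have := List.length_pos_iff.2 (subst_ne_nil (pow_ne_nil hφ n) hu)
    rw [pow_add_apply, pow_one_eq, ha, subst_cons, List.length_append]
    omega

/-- Extremal words of a fixed point of a nonerasing morphism in `M_x` are morphic. -/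
lemma isMorphic_of_isMinimalIn [Finite A] (hφ : ∀ a, φ a ≠ []) {a : A} {u : List A} (hu : u ≠ [])
    (ha : φ a = a :: u) (hx : ∀ n, IsPrefixOf (pow φ n a) x) {p : A → List A}
    (hp : ∀ y ∈ orbitClosure x, IsPrefixOf (p (y 0)) (img φ y))
    (hpp : ∀ a b, a ≠ b → ¬ p a <+: p b) {σ : A → A → Prop} [Std.Asymm σ] [Std.Trichotomous σ]
    {y : ℕ → A} (hy : IsMinimalIn x σ y) : IsMorphic y := by
  have hpre : ∀ n m, n ≤ m → take x n <+: pow φ m a := fun n m hnm =>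
    (isPrefixOf_take x n).prefix_of_le (hx m)
      (by simpa using hnm.trans (length_pow_ge hφ hu ha m))
  have hfix : img φ x = x := by
    symm
    refine eq_img hφ fun n => (hx (1 + n)).of_prefix ?_
    rw [pow_add_apply, pow_one_eq]
    exact subst_prefix φ (hpre n n le_rfl)
  obtain ⟨s, hs, m, k, hk, hys, hss⟩ := exists_isDesubst_self hφ hfix hp hpp hy
  refine isMorphic_of_isDesubst_self hφ hfix hs hys hss fun t ht n => ?_
  obtain ⟨i, hi⟩ := mem_orbitClosure_iff.1 ht n
  refine ⟨i + n, a, ?_⟩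
  rw [pow_mul, hi]
  refine List.IsInfix.trans ?_ (hpre (i + n) _ (Nat.le_mul_of_pos_left _ hk)).isInfix
  rw [take_add]
  exact (List.suffix_append _ _).isInfix

end MorphicWords

theorem mainTheorem1 {A : Type*} [Finite A] (f : FreeMonoid A →* FreeMonoid A) (x : ℕ → A)
    (hx : MorphicWords.IsPureMorphicGeneratedBy f x) (hf : MorphicWords.MemM f x)
    (y : ℕ → A) (hy : MorphicWords.IsExtremal x y) :
    MorphicWords.IsMorphic y := by
  open MorphicWords in
  classical
  obtain ⟨a, u, hu, ha, -, hx⟩ := hx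
  obtain ⟨p, hp0, hp, hpp⟩ := hf
  obtain ⟨σ, b, hσ, hyS, hyb, hmin⟩ := hy
  set ψ : A → List A := fun a => (f (FreeMonoid.of a)).toList with hψ
  have hp' : ∀ y ∈ orbitClosure x, ∃ n, p (y 0) <+: subst ψ (take y n) := by
    intro y hy
    obtain ⟨n, hn⟩ := hp _ y hy rfl
    exact ⟨n, by rwa [toList_eq_subst] at hn⟩
  have hx' : ∀ n, IsPrefixOf (pow ψ n a) x := by
    intro n
    have := hx n
    rwa [toList_iterate_eq_subst] at this
  -- Letters absent from `x` may be erased by `f`. Fixing them instead makes `φ` nonerasing and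
  -- changes nothing on words of the orbit closure.
  let φ : A → List A := fun a => if a ∈ Set.range x then ψ a else [a]
  have hφψ : ∀ i, φ (x i) = ψ (x i) := fun i => if_pos ⟨i, rfl⟩
  have hφ : ∀ a, φ a ≠ [] := by
    intro a
    by_cases h : a ∈ Set.range x
    · obtain ⟨i, rfl⟩ := h
      rw [hφψ]
      exact ne_nil_of_memM hp0 hp' hpp i
    · simp only [φ, if_neg h]
      simp
  have hpow : ∀ n, pow φ n a = pow ψ n a := by
    intro n
    induction n with
    | zero => rfl
    | succ n ih =>
      rw [add_comm, pow_add_apply, pow_add_apply, ih, pow_one_eq, pow_one_eq]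
      refine subst_congr fun c hc => ?_
      obtain ⟨i, hi, rfl⟩ := List.getElem_of_mem hc
      rw [isPrefixOf_iff.1 (hx' n) i hi, hφψ]
  refine isMorphic_of_isMinimalIn (x := x) (σ := σ) hφ (a := a) (u := u.toList) (p := p)
    (fun h => hu h) ?_ (fun n => hpow n ▸ hx' n) ?_ hpp ⟨hyS, ?_⟩
  · have := hpow 1
    rw [pow_one_eq, pow_one_eq] at this
    rw [this, hψ]
    simp [ha]
  · intro z hz
    obtain ⟨n, hn⟩ := hp' z hz
    refine (isPrefixOf_subst_take hφ z n).of_prefix ?_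
    rwa [subst_congr (ψ := ψ)]
    intro c hc
    simp only [take, List.mem_map] at hc
    obtain ⟨i, _, rfl⟩ := hc
    obtain ⟨j, hj⟩ := exists_eq_of_mem_orbitClosure hz i
    rw [hj, hφψ]
  · intro z hz hz0 hlt
    obtain ⟨i, hi, h1⟩ := hlt
    rcases hmin z hz (hz0.trans hyb) with rfl | ⟨j, hj, h2⟩
    · exact asymm h1 h1
    · rcases lt_trichotomy i j with h | rfl | h
      · rw [hj i h] at h1
        exact asymm h1 h1
      · exact asymm h1 h2
      · rw [hi j h] at h2
        exact asymm h2 h2
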